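/- For $\rho\in[-1,1]$ let $(X_t,Y_t)_{t=1}^n$ be i.i.d. pairs of jointly Gaussian, centred, unit-variance real random variables with correlation $\rho$, where party $\mathcal P_1$ observes $X^n=(X_1,\dots,X_n)$, party $\mathcal P_2$ observes $Y^n=(Y_1,\dots,Y_n)$, and both have access to a shared random variable $V$, independent of the observations, whose range and law may be chosen freely. In a one-way test with $\ell$ bits, $\mathcal P_1$ sends a message $\Pi\in\{0,1\}^\ell$ that is a function of $(X^n,V)$, and $\mathcal P_2$ outputs a decision $g(Y^n,\Pi,V)\in\{0,1\}$. For $\delta,\varepsilon\in(0,1)$ and $\tau\in(0,1]$, let $C_1^1(\delta,\varepsilon,\tau)$ be the least $\ell$ such that, for all sufficiently large $n$, there is a one-way test with $\ell$ bits and observation length $n$ for which $$\Pr_\rho[g=1]\le\delta\ \text{ for every } \rho\in[-1,1] \text{ with } |\rho|\ge\tau,\qquad\text{and}\qquad \Pr_{\rho=0}[g=0]\le\varepsilon .$$ Then for every $c\in(0,1)$ there is a constant $K$, depending only on $c$, such that for all $\delta,\varepsilon\in(0,1)$ and $\tau\in(0,1]$ with $\tau\le c$ or $\varepsilon\le c$,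 $$C_1^1(\delta,\varepsilon,\tau)\le \frac1{\tau^2}\left(\sqrt{\log_2\tfrac1\varepsilon}+\sqrt{(1-\tau^2)\log_2\tfrac1\delta}\right)^2+\ln\!\left(\frac2{\tau^2}\left(\sqrt{\ln\tfrac1\varepsilon}+\sqrt{(1-\tau^2)\ln\tfrac1\delta}\right)^2+1\right)+K\sqrt{\log_2\tfrac1\delta\,\log_2\tfrac1\varepsilon}$$ (and in particular $C_1^1(\delta,\varepsilon,\tau)$ is finite). Thus, for each fixed $\tau<1$ the constant in the error term $O\big(\sqrt{\log\frac1\delta\log\frac1\varepsilon}\big)$ is uniform in all $\delta,\varepsilon\in(0,1)$, and for $\varepsilon$ bounded away from $1$ it is uniform in all $\tau\in(0,1]$ and $\delta\in(0,1)$. -/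

import Mathlib

open MeasureTheory ProbabilityTheory Filter

noncomputable section

/-- Joint law of a standard Gaussian pair `(X, Y)` with correlation `ρ ∈ [-1, 1]`:
`Y = ρ X + √(1 - ρ²) Z` with `X`, `Z` independent standard normal variables. -/
def corrGaussian (ρ : ℝ) : Measure (ℝ × ℝ) :=
  ((gaussianReal 0 1).prod (gaussianReal 0 1)).map
    fun p => (p.1, ρ * p.1 + Real.sqrt (1 - ρ ^ 2) * p.2)

/-- Joint law of `n` independent copies `(X_t, Y_t)` of a pair with law `corrGaussian ρ`. -/
def sampleLaw (n : ℕ) (ρ : ℝ) : Measure (Fin n → ℝ × ℝ) :=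
  Measure.pi fun _ => corrGaussian ρ

/-- A one-way (one-round) distributed test with observation length `n` and `ℓ` bits of
communication. Both parties see the shared randomness `V` (an arbitrary random variable,
independent of the observations). The first party sends an `ℓ`-bit message computed from `X^n`
and `V`, and the second party computes a decision in `{0, 1}` from `Y^n`, the message and `V`. -/
structure OneWayTest (n ℓ : ℕ) where
  /-- the range of the shared random variable -/
  V : Type
  [measV : MeasurableSpace V]
  /-- the distribution of the shared random variable -/
  law : Measure V
  [isProb : IsProbabilityMeasure law]
  /-- the message of the first party -/
  msg : (Fin n → ℝ) → V → (Fin ℓ → Bool)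
  measurable_msg : Measurable fun p : (Fin n → ℝ) × V => msg p.1 p.2
  /-- the decision of the second party: `0` declares correlation, `1` declares independence -/
  dec : (Fin n → ℝ) → (Fin ℓ → Bool) → V → Fin 2
  measurable_dec : Measurable fun p : (Fin n → ℝ) × (Fin ℓ → Bool) × V => dec p.1 p.2.1 p.2.2

attribute [instance] OneWayTest.measV OneWayTest.isProb

/-- The output of the test on observations `z = (x_t, y_t)_t` and shared randomness `v`. -/
def OneWayTest.output {n ℓ : ℕ} (T : OneWayTest n ℓ) (z : Fin n → ℝ × ℝ) (v : T.V) : Fin 2 :=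
  T.dec (fun t => (z t).2) (T.msg (fun t => (z t).1) v) v

/-- The probability that the test outputs `b` when the correlation is `ρ`. -/
def OneWayTest.prob {n ℓ : ℕ} (T : OneWayTest n ℓ) (ρ : ℝ) (b : Fin 2) : ℝ :=
  ((sampleLaw n ρ).prod T.law).real {p | T.output p.1 p.2 = b}

/-- `T` tests `|ρ| ≥ τ` against `ρ = 0`: the probability of declaring independence is at most `δ`
for every `ρ ∈ [-1, 1]` with `|ρ| ≥ τ`, and the probability of declaring correlation is at most
`ε` for `ρ = 0`. -/
def OneWayTest.IsTest {n ℓ : ℕ} (T : OneWayTest n ℓ) (δ ε τ : ℝ) : Prop :=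
  (∀ ρ : ℝ, |ρ| ≤ 1 → τ ≤ |ρ| → T.prob ρ 1 ≤ δ) ∧ T.prob 0 0 ≤ ε

/-- `ℓ` bits of one-way communication suffice for all sufficiently large observation lengths. -/
def OneWayAchievable (δ ε τ : ℝ) (ℓ : ℕ) : Prop :=
  ∀ᶠ n : ℕ in atTop, ∃ T : OneWayTest n ℓ, T.IsTest δ ε τ

/-- The minimum one-way communication for one-dimensional correlation testing: the least
achievable number of bits (`⊤` if there is none). -/
def minOneWayComm (δ ε τ : ℝ) : ℕ∞ :=
  ⨅ (ℓ : ℕ) (_ : OneWayAchievable δ ε τ ℓ), (ℓ : ℕ∞)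

end

/-! The message names the index J of the largest of 2^ℓ samples X_t, and the second party declares
correlation when |Y_J| ≥ r = √(2 ln(1/ε)). Given X, Y_J = ρ X_J + √(1-ρ²) Z with Z standard normal,
so for ρ = 0 the error is P(|Z| ≥ r) ≤ ε. If |ρ| ≥ τ and X_J reaches x = `maxThreshold`, where τx =
r + √(1-τ²)√(2 ln(1/δ)), the error is at most δ/2. Reaching x takes a multiple of 1/P(Z ≥ x) ≲
(1+x)e^{x²/2} samples: x²/(2 ln 2) is the main term, and the factor 1+x costs about ln(x²+1)/(2 ln
2) bits.

A maximum below x is handled in two ways. For ε ≤ c, a further factor of order log(2/δ) gives this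
event probability at most δ/2 (`oneWayAchievable_of_log_le`); the log log(1/δ) bits are O(√(log(1/δ)
log(1/ε))). For τ ≤ c a constant factor is enough (`oneWayAchievable_of_tsum_le`): the conditional
error is at most δ T^j with T = exp((x² - (X_J⁺)²)/2), while T has an exponentially small tail.

As 1/(2 ln 2) < 1, additive constants are absorbed by the logarithmic term when x is large, and by
the error term when x is bounded and δ + ε < 1 (`exists_const_absorb`). For δ + ε ≥ 1 no
communication is needed. -/

/-! ### Gaussian tail bounds. -/

/-- The standard normal law is invariant under negation. -/
lemma gaussianReal_Iic_neg (t : ℝ) :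
    gaussianReal 0 1 (Set.Iic (-t)) = gaussianReal 0 1 (Set.Ici t) := by
  have h := gaussianReal_map_neg (μ := 0) (v := 1)
  rw [neg_zero] at h
  nth_rw 1 [← h]
  rw [Measure.map_apply measurable_neg measurableSet_Iic]
  congr 1
  ext z
  simp

lemma gaussianReal_Ici_zero : gaussianReal 0 1 (Set.Ici 0) = ENNReal.ofReal (1 / 2) := by
  have : NullSingletonClass (gaussianReal 0 1) := nullSingletonClass_gaussianReal one_ne_zero
  have h1 : gaussianReal 0 1 (Set.Ici 0) = gaussianReal 0 1 (Set.Iio 0) := by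
    rw [measure_congr (Iio_ae_eq_Iic (μ := gaussianReal 0 1)), ← gaussianReal_Iic_neg, neg_zero]
  have h2 := prob_add_prob_compl (μ := gaussianReal 0 1) (measurableSet_Ici (a := (0 : ℝ)))
  rw [Set.compl_Ici, ← h1, ← two_mul] at h2
  rw [one_div, ENNReal.ofReal_inv_of_pos two_pos, ENNReal.ofReal_ofNat]
  exact ENNReal.eq_inv_of_mul_eq_one_left (by rw [mul_comm]; exact h2)

/-- The sharp Chernoff bound `P(Z ≥ t) ≤ e^{-t²/2} / 2` for a standard normal `Z`. -/
lemma gaussianReal_Ici_le {t : ℝ} (ht : 0 ≤ t) :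
    gaussianReal 0 1 (Set.Ici t) ≤ ENNReal.ofReal (Real.exp (-t ^ 2 / 2) / 2) := by
  have h1 : gaussianReal 0 1 (Set.Ici t) = gaussianReal (-t) 1 (Set.Ici 0) := by
    have h := gaussianReal_map_add_const (μ := 0) (v := 1) (-t)
    rw [zero_add] at h
    rw [← h, Measure.map_apply (by fun_prop) measurableSet_Ici]
    congr 1
    ext z
    simp
  rw [h1, gaussianReal_apply _ one_ne_zero]
  -- For z, t ≥ 0, (z+t)² ≥ z² + t²; the factor 1/2 is P(Z ≥ 0).
  calc ∫⁻ z in Set.Ici 0, gaussianPDF (-t) 1 z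
      ≤ ∫⁻ z in Set.Ici 0, ENNReal.ofReal (Real.exp (-t ^ 2 / 2)) * gaussianPDF 0 1 z := by
        refine setLIntegral_mono' measurableSet_Ici fun z hz => ?_
        rw [gaussianPDF, gaussianPDF, ← ENNReal.ofReal_mul (Real.exp_pos _).le]
        refine ENNReal.ofReal_le_ofReal ?_
        rw [gaussianPDFReal, gaussianPDFReal, mul_left_comm, ← Real.exp_add]
        gcongr
        have : 0 ≤ t * z := mul_nonneg ht hz
        simp only [NNReal.coe_one]
        nlinarith
    _ = ENNReal.ofReal (Real.exp (-t ^ 2 / 2) / 2) := by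
        rw [lintegral_const_mul _ (measurable_gaussianPDF 0 1), ← gaussianReal_apply _ one_ne_zero,
          gaussianReal_Ici_zero, ← ENNReal.ofReal_mul (Real.exp_pos _).le]
        congr 1
        ring

/-- `P(|Z| ≥ t) ≤ e^{-t²/2}` for a standard normal `Z`. -/
lemma gaussianReal_le_abs_le {t : ℝ} (ht : 0 ≤ t) :
    gaussianReal 0 1 {z | t ≤ |z|} ≤ ENNReal.ofReal (Real.exp (-t ^ 2 / 2)) := by
  have hs : {z : ℝ | t ≤ |z|} ⊆ Set.Ici t ∪ Set.Iic (-t) := by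
    intro z hz
    change t ≤ |z| at hz
    rcases le_abs.1 hz with h | h
    · exact Or.inl h
    · exact Or.inr (by simp only [Set.mem_Iic]; linarith)
  refine (measure_mono hs).trans ((measure_union_le _ _).trans ?_)
  rw [gaussianReal_Iic_neg]
  refine (add_le_add (gaussianReal_Ici_le ht) (gaussianReal_Ici_le ht)).trans_eq ?_
  rw [← ENNReal.ofReal_add (by positivity) (by positivity)]
  congr 1
  ring

/-- A lower bound, of the correct order, for the upper tail of a standard normal. -/
noncomputable def gaussianTailLower (y : ℝ) : ℝ :=
  (Real.sqrt (2 * Real.pi))⁻¹ * Real.exp (-3 / 2) / (1 + y) * Real.exp (-y ^ 2 / 2)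

lemma gaussianTailLower_pos {y : ℝ} (hy : 0 ≤ y) : 0 < gaussianTailLower y := by
  unfold gaussianTailLower
  positivity

/-- On [y, y + 1/(1+y)] one has z² ≤ y² + 3, so the density there loses only the factor e^{-3/2}. -/
lemma le_gaussianReal_Ici {y : ℝ} (hy : 0 ≤ y) :
    ENNReal.ofReal (gaussianTailLower y) ≤ gaussianReal 0 1 (Set.Ici y) := by
  set b := (Real.sqrt (2 * Real.pi))⁻¹ * Real.exp (-3 / 2) * Real.exp (-y ^ 2 / 2) with hb
  have hw : 0 < 1 / (1 + y) := by positivity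
  have h1 : ENNReal.ofReal b * volume (Set.Icc y (y + 1 / (1 + y)))
      ≤ ∫⁻ z in Set.Icc y (y + 1 / (1 + y)), gaussianPDF 0 1 z := by
    rw [← setLIntegral_const]
    refine setLIntegral_mono' measurableSet_Icc fun z hz => ?_
    refine ENNReal.ofReal_le_ofReal ?_
    rw [gaussianPDFReal, hb, mul_assoc, ← Real.exp_add]
    simp only [NNReal.coe_one, mul_one, sub_zero]
    gcongr
    have h2 : z ^ 2 ≤ (y + 1 / (1 + y)) ^ 2 := pow_le_pow_left₀ (hy.trans hz.1) hz.2 2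
    have h3 : y * (1 / (1 + y)) ≤ 1 := by
      rw [mul_one_div, div_le_one (by positivity)]; linarith
    have h4 : 1 / (1 + y) ≤ 1 := by
      rw [div_le_one (by positivity)]; linarith
    nlinarith
  calc _ = ENNReal.ofReal b * volume (Set.Icc y (y + 1 / (1 + y))) := by
        rw [Real.volume_Icc, ← ENNReal.ofReal_mul (by positivity)]
        congr 1
        rw [hb, gaussianTailLower]; ring
    _ ≤ _ := h1
    _ = gaussianReal 0 1 (Set.Icc y (y + 1 / (1 + y))) := (gaussianReal_apply _ one_ne_zero _).symm
    _ ≤ _ := measure_mono Set.Icc_subset_Ici_self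

/-- If `|ρ| ≥ τ` and `√(1 - τ²) w + r ≤ τ y`, then `ρ y + √(1 - ρ²) Z` falls into `(-r, r)` with
probability at most `e^{-w²/2} / 2`. -/
lemma gaussianReal_abs_affine_lt_le {τ ρ r w y : ℝ} (hτ : 0 < τ) (hρ : τ ≤ |ρ|) (hr : 0 ≤ r)
    (hw : 0 ≤ w) (h : Real.sqrt (1 - τ ^ 2) * w + r ≤ τ * y) :
    gaussianReal 0 1 {z | |ρ * y + Real.sqrt (1 - ρ ^ 2) * z| < r}
      ≤ ENNReal.ofReal (Real.exp (-w ^ 2 / 2) / 2) := by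
  have hσ : Real.sqrt (1 - ρ ^ 2) ≤ Real.sqrt (1 - τ ^ 2) := by
    apply Real.sqrt_le_sqrt
    have := pow_le_pow_left₀ hτ.le hρ 2
    rw [sq_abs] at this
    linarith
  set s := Real.sqrt (1 - τ ^ 2)
  set σ := Real.sqrt (1 - ρ ^ 2)
  have hσ0 : 0 ≤ σ := Real.sqrt_nonneg _
  have hy : 0 ≤ y := by
    have : 0 ≤ s * w := mul_nonneg (hσ0.trans hσ) hw
    by_contra! hneg
    nlinarith
  have hσw : σ * w ≤ s * w := by gcongr
  refine le_trans ?_ (gaussianReal_Ici_le hw)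
  -- Since |ρ|y ≥ σw + r, the event forces Z into a single tail beyond w, whose side depends on the
  -- sign of ρ.
  rcases le_abs.1 hρ with h1 | h1
  · rw [← gaussianReal_Iic_neg]
    refine measure_mono fun z hz => ?_
    change |ρ * y + σ * z| < r at hz
    have hz := (abs_lt.1 hz).2
    simp only [Set.mem_Iic]
    by_contra! hc
    nlinarith [mul_le_mul_of_nonneg_right h1 hy, mul_le_mul_of_nonneg_left hc.le hσ0]
  · refine measure_mono fun z hz => ?_
    change |ρ * y + σ * z| < r at hz
    have hz := (abs_lt.1 hz).1
    simp only [Set.mem_Ici]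
    by_contra! hc
    nlinarith [mul_le_mul_of_nonneg_right h1 hy, mul_le_mul_of_nonneg_left hc.le hσ0]

/-! ### The law of the selected observation. -/

/-- A measurable selection of an index at which a finite family of reals is maximal. -/
lemma exists_measurable_argmax (ι : Type*) [Finite ι] [Nonempty ι] [MeasurableSpace ι] :
    ∃ J : (ι → ℝ) → ι, Measurable J ∧ ∀ (a : ι → ℝ) i, a i ≤ a (J a) := by
  classical
  obtain ⟨f, hf⟩ := exists_surjective_nat ι
  have hex : ∀ a : ι → ℝ, ∃ k, ∀ i, a i ≤ a (f k) := fun a => by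
    obtain ⟨m, hm⟩ := Finite.exists_max a
    obtain ⟨k, rfl⟩ := hf m
    exact ⟨k, hm⟩
  -- Taking the first maximiser in a fixed enumeration makes the choice measurable.
  refine ⟨fun a => f (Nat.find (hex a)), ?_, fun a => Nat.find_spec (hex a)⟩
  refine (measurable_from_nat (f := f)).comp (measurable_find hex fun k => ?_)
  rw [Set.ofPred_forall]
  exact MeasurableSet.iInter fun i => measurableSet_le (measurable_pi_apply i) (measurable_pi_apply _)

/-- The independent samples as the image of two independent standard normal vectors. -/
lemma sampleLaw_eq_map (n : ℕ) (ρ : ℝ) :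
    sampleLaw n ρ = ((Measure.pi fun _ : Fin n => gaussianReal 0 1).prod
      (Measure.pi fun _ : Fin n => gaussianReal 0 1)).map
        fun p t => (p.1 t, ρ * p.1 t + Real.sqrt (1 - ρ ^ 2) * p.2 t) := by
  have hm : Measurable fun p : ℝ × ℝ => (p.1, ρ * p.1 + Real.sqrt (1 - ρ ^ 2) * p.2) := by fun_prop
  have : IsProbabilityMeasure (((gaussianReal 0 1).prod (gaussianReal 0 1)).map
      fun p : ℝ × ℝ => (p.1, ρ * p.1 + Real.sqrt (1 - ρ ^ 2) * p.2)) :=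
    Measure.isProbabilityMeasure_map hm.aemeasurable
  have h := measurePreserving_arrowProdEquivProdArrow ℝ ℝ (Fin n)
    (fun _ => gaussianReal 0 1) (fun _ => gaussianReal 0 1)
  unfold sampleLaw corrGaussian
  rw [← Measure.pi_map_pi fun _ => hm.aemeasurable, ← h.map_eq, Measure.map_map (by fun_prop) h.measurable]
  rfl

instance (n : ℕ) (ρ : ℝ) : IsProbabilityMeasure (sampleLaw n ρ) := by
  rw [sampleLaw_eq_map]
  exact Measure.isProbabilityMeasure_map (by fun_prop)

/-- Conditionally on `X`, the observation `Y_J` at an index `J` chosen from `X` is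
`ρ X_J + √(1 - ρ²) Z` with `Z` standard normal. -/
lemma sampleLaw_select (n : ℕ) (ρ : ℝ) (J : (Fin n → ℝ) → Fin n) (hJ : Measurable J)
    (S : Set ℝ) (hS : MeasurableSet S) :
    sampleLaw n ρ {z | (z (J fun t => (z t).1)).2 ∈ S} =
      ∫⁻ a, gaussianReal 0 1 {z | ρ * a (J a) + Real.sqrt (1 - ρ ^ 2) * z ∈ S}
        ∂Measure.pi fun _ : Fin n => gaussianReal 0 1 := by
  have hev : Measurable fun p : Fin n × (Fin n → ℝ) => p.2 p.1 :=
    measurable_from_prod_countable_right fun i => measurable_pi_apply i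
  have hfst : Measurable fun z : Fin n → ℝ × ℝ => fun t => (z t).1 := by fun_prop
  have hsnd : Measurable fun z : Fin n → ℝ × ℝ => fun t => (z t).2 := by fun_prop
  have hset : MeasurableSet {z : Fin n → ℝ × ℝ | (z (J fun t => (z t).1)).2 ∈ S} :=
    (hev.comp ((hJ.comp hfst).prodMk hsnd)) hS
  have hmap : Measurable fun (p : (Fin n → ℝ) × (Fin n → ℝ)) (t : Fin n) =>
      (p.1 t, ρ * p.1 t + Real.sqrt (1 - ρ ^ 2) * p.2 t) := by fun_prop
  rw [sampleLaw_eq_map, Measure.map_apply hmap hset, Measure.prod_apply (hmap hset)]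
  refine lintegral_congr fun a => ?_
  rw [← (measurePreserving_eval (fun _ : Fin n => gaussianReal 0 1) (J a)).measure_preimage]
  · rfl
  · exact ((by fun_prop : Measurable fun z : ℝ => ρ * a (J a) + Real.sqrt (1 - ρ ^ 2) * z) hS).nullMeasurableSet

/-- The maximum of `M` standard normal coordinates is below `y` with probability `P(Z < y)^M`. -/
lemma pi_gaussianReal_forall_lt_le {n : ℕ} {ι : Type*} [Fintype ι] (e : ι ↪ Fin n) (y : ℝ) :
    (Measure.pi fun _ : Fin n => gaussianReal 0 1) {a | ∀ m, a (e m) < y}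
      ≤ gaussianReal 0 1 (Set.Iio y) ^ Fintype.card ι := by
  classical
  have hs : {a : Fin n → ℝ | ∀ m, a (e m) < y} ⊆
      Set.univ.pi fun i => if i ∈ Finset.univ.map e then Set.Iio y else Set.univ := by
    intro a ha i _
    dsimp only
    split_ifs with hi
    · obtain ⟨m, -, rfl⟩ := Finset.mem_map.1 hi
      exact ha m
    · trivial
  refine (measure_mono hs).trans_eq ?_
  rw [Measure.pi_pi]
  simp_rw [apply_ite (gaussianReal 0 1), measure_univ]
  rw [Finset.prod_ite_mem, Finset.univ_inter, Finset.prod_const, Finset.card_map, Finset.card_univ]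

lemma pi_gaussianReal_forall_lt_le_exp {n : ℕ} {ι : Type*} [Fintype ι] (e : ι ↪ Fin n) {y B : ℝ}
    (hy : 0 ≤ y) (hB : B ≤ Fintype.card ι * gaussianTailLower y) :
    (Measure.pi fun _ : Fin n => gaussianReal 0 1) {a | ∀ m, a (e m) < y}
      ≤ ENNReal.ofReal (Real.exp (-B)) := by
  refine (pi_gaussianReal_forall_lt_le e y).trans ?_
  set q := gaussianTailLower y
  have hq : 0 ≤ q := (gaussianTailLower_pos hy).le
  have h1 : gaussianReal 0 1 (Set.Iio y) ≤ ENNReal.ofReal (Real.exp (-q)) := by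
    rw [← Set.compl_Ici, prob_compl_eq_one_sub measurableSet_Ici]
    calc 1 - gaussianReal 0 1 (Set.Ici y) ≤ 1 - ENNReal.ofReal q :=
          tsub_le_tsub_left (le_gaussianReal_Ici hy) _
      _ = ENNReal.ofReal (1 - q) := by rw [ENNReal.ofReal_sub _ hq, ENNReal.ofReal_one]
      _ ≤ _ := ENNReal.ofReal_le_ofReal (Real.one_sub_le_exp_neg q)
  calc _ ≤ ENNReal.ofReal (Real.exp (-q)) ^ Fintype.card ι := by gcongr
    _ = ENNReal.ofReal (Real.exp (-(Fintype.card ι * q))) := by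
        rw [← ENNReal.ofReal_pow (Real.exp_pos _).le, ← Real.exp_nat_mul, mul_neg]
    _ ≤ _ := by gcongr

/-! ### The tests. -/

/-- The test that communicates the position of the largest of `2 ^ ℓ` samples: its error
probabilities. -/
lemma exists_argmax_test {n ℓ : ℕ} (e : (Fin ℓ → Bool) ↪ Fin n) (r : ℝ) :
    ∃ (T : OneWayTest n ℓ) (J : (Fin n → ℝ) → Fin ℓ → Bool), Measurable J ∧
      (∀ (a : Fin n → ℝ) m, a (e m) ≤ a (e (J a))) ∧
      (∀ ρ, T.prob ρ 1 = (∫⁻ a, gaussianReal 0 1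
        {z | |ρ * a (e (J a)) + Real.sqrt (1 - ρ ^ 2) * z| < r}
          ∂Measure.pi fun _ : Fin n => gaussianReal 0 1).toReal) ∧
      T.prob 0 0 = (gaussianReal 0 1).real {z | r ≤ |z|} := by
  classical
  obtain ⟨J₀, hJ₀, hmax⟩ := exists_measurable_argmax (Fin ℓ → Bool)
  set J : (Fin n → ℝ) → Fin ℓ → Bool := fun a => J₀ fun m => a (e m) with hJdef
  have hJ : Measurable J := hJ₀.comp (by fun_prop)
  have heJ : Measurable fun a => e (J a) := (measurable_of_countable e).comp hJ
  have hev : Measurable fun p : (Fin n → ℝ) × (Fin ℓ → Bool) × Unit => p.1 (e p.2.1) := by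
    have h : Measurable fun p : Fin n × (Fin n → ℝ) => p.2 p.1 :=
      measurable_from_prod_countable_right fun i => measurable_pi_apply i
    exact h.comp (((measurable_of_countable e).comp
      (measurable_fst.comp measurable_snd)).prodMk measurable_fst)
  let T : OneWayTest n ℓ :=
    { V := Unit
      law := Measure.dirac ()
      msg := fun a _ => J a
      measurable_msg := hJ.comp measurable_fst
      dec := fun y m _ => if r ≤ |y (e m)| then 0 else 1
      measurable_dec := Measurable.ite (measurableSet_le measurable_const hev.abs)
        measurable_const measurable_const }
  have hprob : ∀ ρ b, T.prob ρ b = (sampleLaw n ρ).real {z | T.output z () = b} := by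
    intro ρ b
    have : {p : (Fin n → ℝ × ℝ) × T.V | T.output p.1 p.2 = b}
        = {z | T.output z () = b} ×ˢ Set.univ := by
      ext ⟨z, ⟨⟩⟩
      simp
    rw [OneWayTest.prob, this, measureReal_prod_prod]
    simp
  refine ⟨T, J, hJ, fun a m => hmax (fun m => a (e m)) m, fun ρ => ?_, ?_⟩
  · rw [hprob, measureReal_def]
    have h := sampleLaw_select n ρ (fun a => e (J a)) heJ {y | |y| < r}
      (measurableSet_lt measurable_id.abs measurable_const)
    simp only [Set.mem_ofPred_eq] at h
    rw [← h]
    congr 2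
    ext z
    simp [OneWayTest.output, T]
  · rw [hprob, measureReal_def, measureReal_def]
    have h := sampleLaw_select n 0 (fun a => e (J a)) heJ {y | r ≤ |y|}
      (measurableSet_le measurable_const measurable_id.abs)
    simp only [Set.mem_ofPred_eq, zero_mul, zero_add, ne_eq, OfNat.ofNat_ne_zero, not_false_eq_true,
      zero_pow, sub_zero, Real.sqrt_one, one_mul, lintegral_const, measure_univ, mul_one] at h
    rw [← h]
    congr 2
    ext z
    simp [OneWayTest.output, T]

/-- Without communication, the parties can declare independence with probability `δ`. -/
lemma oneWayAchievable_zero {δ ε τ : ℝ} (hδ : 0 < δ) (hδ1 : δ < 1) (h : 1 ≤ δ + ε) :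
    OneWayAchievable δ ε τ 0 := by
  refine Eventually.of_forall fun n => ?_
  let p : NNReal := ⟨δ, hδ.le⟩
  let μ : Measure Bool := ENNReal.ofReal δ • Measure.dirac true
    + ENNReal.ofReal (1 - δ) • Measure.dirac false
  have hμ : IsProbabilityMeasure μ := ⟨by
    simp only [μ, Measure.add_apply, Measure.smul_apply, measure_univ, smul_eq_mul, mul_one]
    rw [← ENNReal.ofReal_add hδ.le (by linarith)]
    simp⟩
  let T : OneWayTest n 0 :=
    { V := Bool
      law := μ
      msg := fun _ _ => default
      measurable_msg := measurable_const
      dec := fun _ _ v => if v = true then 1 else 0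
      measurable_dec := (measurable_of_countable fun v : Bool => (if v = true then 1 else 0 : Fin 2)).comp
        (measurable_snd.comp measurable_snd) }
  have hprob : ∀ ρ b, T.prob ρ b = μ.real {v | (if v = true then 1 else 0 : Fin 2) = b} := by
    intro ρ b
    have : {p : (Fin n → ℝ × ℝ) × T.V | T.output p.1 p.2 = b}
        = Set.univ ×ˢ {v : Bool | (if v = true then 1 else 0 : Fin 2) = b} := by
      ext ⟨z, v⟩
      simp [OneWayTest.output, T]
    rw [OneWayTest.prob, this, measureReal_prod_prod]
    simp [T]
  refine ⟨T, fun ρ _ _ => ?_, ?_⟩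
  · rw [hprob]
    simp [μ, measureReal_def, hδ.le]
  · rw [hprob]
    simp [μ, measureReal_def, hδ1.le]
    linarith

/-! ### Error given the largest sample. -/

/-- The value that the largest communicated sample should reach. -/
noncomputable def maxThreshold (δ ε τ : ℝ) : ℝ :=
  (Real.sqrt (2 * Real.log (1 / ε)) + Real.sqrt (1 - τ ^ 2) * Real.sqrt (2 * Real.log (1 / δ))) / τ

lemma exp_neg_sq_sqrt {δ : ℝ} (hδ : 0 < δ) (hδ1 : δ < 1) :
    Real.exp (-Real.sqrt (2 * Real.log (1 / δ)) ^ 2 / 2) = δ := by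
  have h : 0 ≤ Real.log (1 / δ) := Real.log_nonneg (by rw [le_div_iff₀ hδ]; linarith)
  rw [Real.sq_sqrt (by positivity), one_div, Real.log_inv]
  rw [show -(2 * -Real.log δ) / 2 = Real.log δ by ring, Real.exp_log hδ]

lemma sqrt_two_log_pos {ε : ℝ} (hε : 0 < ε) (hε1 : ε < 1) :
    0 < Real.sqrt (2 * Real.log (1 / ε)) := by
  have : 0 < Real.log (1 / ε) := Real.log_pos (by rw [lt_div_iff₀ hε]; linarith)
  positivity

lemma maxThreshold_pos {δ ε τ : ℝ} (hε : 0 < ε) (hε1 : ε < 1) (hτ : 0 < τ) :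
    0 < maxThreshold δ ε τ :=
  div_pos (add_pos_of_pos_of_nonneg (sqrt_two_log_pos hε hε1)
    (mul_nonneg (Real.sqrt_nonneg _) (Real.sqrt_nonneg _))) hτ

lemma mul_maxThreshold (δ ε : ℝ) {τ : ℝ} (hτ : 0 < τ) :
    τ * maxThreshold δ ε τ = Real.sqrt (2 * Real.log (1 / ε))
      + Real.sqrt (1 - τ ^ 2) * Real.sqrt (2 * Real.log (1 / δ)) := by
  rw [maxThreshold]
  field_simp

/-- A one-way test exists as soon as the largest of `2 ^ ℓ` samples is informative enough. -/
lemma oneWayAchievable_of_lintegral_le {δ ε τ : ℝ} {ℓ : ℕ} (hδ : 0 < δ) (hε : 0 < ε) (hε1 : ε < 1)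
    (h : ∀ (n : ℕ) (e : (Fin ℓ → Bool) ↪ Fin n) (X : (Fin n → ℝ) → ℝ), Measurable X →
      (∀ (a : Fin n → ℝ) m, a (e m) ≤ X a) → ∀ ρ : ℝ, τ ≤ |ρ| →
        ∫⁻ a, gaussianReal 0 1 {z | |ρ * X a + Real.sqrt (1 - ρ ^ 2) * z|
          < Real.sqrt (2 * Real.log (1 / ε))} ∂(Measure.pi fun _ : Fin n => gaussianReal 0 1)
            ≤ ENNReal.ofReal δ) :
    OneWayAchievable δ ε τ ℓ := by
  -- With n ≥ 2^ℓ, distinct messages can name distinct samples.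
  filter_upwards [eventually_ge_atTop (2 ^ ℓ)] with n hn
  obtain ⟨e⟩ : Nonempty ((Fin ℓ → Bool) ↪ Fin n) :=
    Function.Embedding.nonempty_of_card_le (by simpa using hn)
  obtain ⟨T, J, hJ, hmax, hT1, hT0⟩ := exists_argmax_test e (Real.sqrt (2 * Real.log (1 / ε)))
  have hX : Measurable fun a : Fin n → ℝ => a (e (J a)) := by
    have h : Measurable fun p : Fin n × (Fin n → ℝ) => p.2 p.1 :=
      measurable_from_prod_countable_right fun i => measurable_pi_apply i
    exact h.comp (((measurable_of_countable e).comp hJ).prodMk measurable_id)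
  refine ⟨T, fun ρ _ hρ => ?_, ?_⟩
  · rw [hT1]
    exact ENNReal.toReal_le_of_le_ofReal hδ.le (h n e _ hX hmax ρ hρ)
  · rw [hT0, measureReal_def]
    refine ENNReal.toReal_le_of_le_ofReal hε.le ?_
    refine (gaussianReal_le_abs_le (Real.sqrt_nonneg _)).trans_eq ?_
    rw [exp_neg_sq_sqrt hε hε1]

lemma condError_le_of_maxThreshold_le {δ ε τ ρ v : ℝ} (hδ : 0 < δ) (hδ1 : δ < 1)
    (hτ : 0 < τ) (hρ : τ ≤ |ρ|) (hv : maxThreshold δ ε τ ≤ v) :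
    gaussianReal 0 1 {z | |ρ * v + Real.sqrt (1 - ρ ^ 2) * z| < Real.sqrt (2 * Real.log (1 / ε))}
      ≤ ENNReal.ofReal (δ / 2) := by
  refine (gaussianReal_abs_affine_lt_le hτ hρ (Real.sqrt_nonneg _)
    (Real.sqrt_nonneg (2 * Real.log (1 / δ))) ?_).trans_eq ?_
  · have := mul_le_mul_of_nonneg_left hv hτ.le
    rw [mul_maxThreshold δ ε hτ] at this
    linarith
  · rw [exp_neg_sq_sqrt hδ hδ1]

/-- With p = τ/√(1-τ²), lowering the maximum from x to v lowers the usable Gaussian deviation from d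
= √(2 ln(1/δ)) to w = d - p(x-v). The exponent d²/2 drops by at most dp(x-v), and d ≤ px bounds this
by p²(x²-v²) for 0 ≤ v, hence by j(x²-v²)/2. -/
lemma condError_le_of_lt_maxThreshold {δ ε τ ρ v : ℝ} {j : ℕ} (hδ : 0 < δ) (hδ1 : δ < 1)
    (hε : 0 < ε) (hε1 : ε < 1) (hτ : 0 < τ) (hj : 2 * τ ^ 2 ≤ j * (1 - τ ^ 2))
    (hρ : τ ≤ |ρ|) (hv : v < maxThreshold δ ε τ) :
    gaussianReal 0 1 {z | |ρ * v + Real.sqrt (1 - ρ ^ 2) * z| < Real.sqrt (2 * Real.log (1 / ε))}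
      ≤ ENNReal.ofReal (δ * Real.exp ((maxThreshold δ ε τ ^ 2 - max v 0 ^ 2) / 2) ^ j) := by
  have hx0 := maxThreshold_pos (δ := δ) hε hε1 hτ
  have hτx := mul_maxThreshold δ ε hτ
  have hδe := exp_neg_sq_sqrt hδ hδ1
  have hr := sqrt_two_log_pos hε hε1
  have hd : 0 ≤ Real.sqrt (2 * Real.log (1 / δ)) := Real.sqrt_nonneg _
  have hτ1 : 0 < 1 - τ ^ 2 := by
    by_contra! hneg
    nlinarith [mul_nonpos_of_nonneg_of_nonpos (Nat.cast_nonneg (α := ℝ) j) hneg]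
  have hs2 : Real.sqrt (1 - τ ^ 2) ^ 2 = 1 - τ ^ 2 := Real.sq_sqrt hτ1.le
  have hs : 0 < Real.sqrt (1 - τ ^ 2) := Real.sqrt_pos.2 hτ1
  set x := maxThreshold δ ε τ
  set d := Real.sqrt (2 * Real.log (1 / δ))
  set r := Real.sqrt (2 * Real.log (1 / ε))
  set s := Real.sqrt (1 - τ ^ 2)
  set y := max v 0 with hy
  have hy0 : 0 ≤ y := le_max_right _ _
  have hyx : y < x := max_lt hv hx0
  obtain ⟨p, hp⟩ : ∃ p, s * p = τ := ⟨τ / s, by field_simp⟩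
  have hp0 : 0 < p := by
    by_contra! hneg
    nlinarith
  have hdp : d ≤ p * x := by
    refine le_of_mul_le_mul_left ?_ hs
    rw [← mul_assoc, hp]
    linarith
  have hpj : 2 * p ^ 2 ≤ j := by
    have : s ^ 2 * (2 * p ^ 2) ≤ s ^ 2 * j := by
      rw [show s ^ 2 * (2 * p ^ 2) = 2 * (s * p) ^ 2 by ring, hp, hs2]
      linarith
    exact le_of_mul_le_mul_left this (by positivity)
  have hkey : d * p * (x - y) ≤ j * ((x ^ 2 - y ^ 2) / 2) := by
    have h1 : d * p * (x - y) ≤ p * x * p * (x - y) := by gcongr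
    have h2 : x * (x - y) ≤ x ^ 2 - y ^ 2 := by nlinarith
    have h3 : 2 * p ^ 2 * (x * (x - y)) ≤ j * (x ^ 2 - y ^ 2) :=
      mul_le_mul hpj h2 (mul_nonneg hx0.le (by linarith)) (by positivity)
    nlinarith
  have hbound : δ * Real.exp ((x ^ 2 - y ^ 2) / 2) ^ j
      = Real.exp (-d ^ 2 / 2 + j * ((x ^ 2 - y ^ 2) / 2)) := by
    rw [Real.exp_add, hδe, ← Real.exp_nat_mul]
  rw [hbound]
  -- A negative deviation makes the claimed bound at least 1. Otherwise v ≥ 0, as y = 0 would give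
  -- s·w + r = 0 with r > 0.
  rcases le_or_gt 0 (d - p * (x - y)) with hw | hw
  · have hτy : s * (d - p * (x - y)) + r = τ * y := by
      have : s * (p * (x - y)) = τ * (x - y) := by rw [← mul_assoc, hp]
      rw [mul_sub, this, mul_sub]
      linarith
    have hvy : y = v := by
      refine max_eq_left ?_
      by_contra! hneg
      have h0 : y = 0 := max_eq_right hneg.le
      rw [h0] at hτy hw
      nlinarith [mul_nonneg hs.le hw]
    rw [hvy] at hτy hw
    refine (gaussianReal_abs_affine_lt_le hτ hρ hr.le hw hτy.le).trans
      (ENNReal.ofReal_le_ofReal ?_)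
    refine (half_le_self (Real.exp_pos _).le).trans (Real.exp_le_exp.2 ?_)
    rw [hvy] at hkey ⊢
    nlinarith [sq_nonneg (p * (x - v))]
  · refine prob_le_one.trans ?_
    rw [← ENNReal.ofReal_one]
    refine ENNReal.ofReal_le_ofReal (Real.one_le_exp ?_)
    nlinarith

/-! ### Averaging over the largest sample. -/

/-- Achievability with a message length that pays for `log log (1 / δ)`. -/
lemma oneWayAchievable_of_log_le {δ ε τ : ℝ} {ℓ : ℕ} (hδ : 0 < δ) (hδ1 : δ < 1)
    (hε : 0 < ε) (hε1 : ε < 1) (hτ : 0 < τ)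
    (hℓ : Real.log (2 / δ) ≤ 2 ^ ℓ * gaussianTailLower (maxThreshold δ ε τ)) :
    OneWayAchievable δ ε τ ℓ := by
  refine oneWayAchievable_of_lintegral_le hδ hε hε1 fun n e X hX hmax ρ hρ => ?_
  set x := maxThreshold δ ε τ with hx
  have hE : MeasurableSet {a | X a < x} := measurableSet_lt hX measurable_const
  calc _ ≤ ∫⁻ a, (ENNReal.ofReal (δ / 2) + {a | X a < x}.indicator (fun _ => 1) a)
        ∂(Measure.pi fun _ : Fin n => gaussianReal 0 1) := by
        refine lintegral_mono fun a => ?_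
        rcases lt_or_ge (X a) x with h | h
        · rw [Set.indicator_of_mem (by exact h)]
          exact prob_le_one.trans le_add_self
        · exact (condError_le_of_maxThreshold_le hδ hδ1 hτ hρ h).trans le_self_add
    _ = ENNReal.ofReal (δ / 2)
        + (Measure.pi fun _ : Fin n => gaussianReal 0 1) {a | X a < x} := by
        rw [lintegral_add_left measurable_const, lintegral_indicator_const hE]
        simp
    _ ≤ ENNReal.ofReal (δ / 2) + ENNReal.ofReal (δ / 2) := by
        gcongr
        refine (measure_mono fun a (ha : X a < x) m => (hmax a m).trans_lt ha).trans
          ((pi_gaussianReal_forall_lt_le_exp (B := Real.log (2 / δ)) e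
            (maxThreshold_pos hε hε1 hτ).le (by simpa using hℓ)).trans_eq ?_)
        rw [Real.exp_neg, Real.exp_log (by positivity), inv_div]
    _ = ENNReal.ofReal δ := by
        rw [← ENNReal.ofReal_add (by positivity) (by positivity), add_halves]

/-- The series converges at A = 1, with sum S; adding log(2S+1) to A divides every term by at least
2S+1. As A depends on j alone, it costs a constant number of bits. -/
lemma exists_tsum_pow_mul_exp_le (j : ℕ) : ∃ A : ℝ, 1 ≤ A ∧
    ∑' k : ℕ, ENNReal.ofReal (((k : ℝ) + 2) ^ j * Real.exp (-(A * (k + 1))))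
      ≤ ENNReal.ofReal (1 / 2) := by
  have hs : Summable fun k : ℕ => ((k : ℝ) + 2) ^ j * Real.exp (-(k + 1)) := by
    have h := ((summable_nat_add_iff 2).2
      (Real.summable_pow_mul_exp_neg_nat_mul j one_pos)).mul_left (Real.exp 1)
    refine h.congr fun k => ?_
    rw [mul_left_comm, ← Real.exp_add]
    push_cast
    ring_nf
  set S := ∑' k : ℕ, ((k : ℝ) + 2) ^ j * Real.exp (-(k + 1)) with hS
  have hS0 : 0 ≤ S := tsum_nonneg fun k => by positivity
  have ha : 0 ≤ Real.log (2 * S + 1) := Real.log_nonneg (by linarith)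
  refine ⟨1 + Real.log (2 * S + 1), by linarith, ?_⟩
  calc _ ≤ ∑' k : ℕ, ENNReal.ofReal
          ((2 * S + 1)⁻¹ * (((k : ℝ) + 2) ^ j * Real.exp (-(k + 1)))) := by
        refine ENNReal.tsum_le_tsum fun k => ENNReal.ofReal_le_ofReal ?_
        have h1 : (2 * S + 1)⁻¹ = Real.exp (-Real.log (2 * S + 1)) := by
          rw [Real.exp_neg, Real.exp_log (by linarith)]
        rw [h1, mul_left_comm, ← Real.exp_add]
        gcongr
        have : (0 : ℝ) ≤ k := Nat.cast_nonneg k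
        nlinarith
    _ = ENNReal.ofReal ((2 * S + 1)⁻¹ * S) := by
        rw [← ENNReal.ofReal_tsum_of_nonneg (fun k => by positivity) (hs.mul_left _), tsum_mul_left]
    _ ≤ _ := by
        refine ENNReal.ofReal_le_ofReal ?_
        rw [inv_mul_le_iff₀ (by linarith)]
        linarith

/-- The lower tail of the largest of `2 ^ ℓ` samples is doubly exponentially small. -/
lemma pi_gaussianReal_lt_exp_le {n ℓ : ℕ} (e : (Fin ℓ → Bool) ↪ Fin n) {X : (Fin n → ℝ) → ℝ}
    (hmax : ∀ (a : Fin n → ℝ) m, a (e m) ≤ X a) {x A t : ℝ} (hx : 0 < x) (ht : 1 ≤ t)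
    (hℓ : A ≤ 2 ^ ℓ * gaussianTailLower x) :
    (Measure.pi fun _ : Fin n => gaussianReal 0 1)
      {a | t < Real.exp ((x ^ 2 - max (X a) 0 ^ 2) / 2)} ≤ ENNReal.ofReal (Real.exp (-(A * t))) := by
  have hlog : ∀ a, t < Real.exp ((x ^ 2 - max (X a) 0 ^ 2) / 2) →
      max (X a) 0 ^ 2 < x ^ 2 - 2 * Real.log t := fun a ha => by
    have := (Real.log_lt_iff_lt_exp (by linarith)).2 ha
    linarith
  have hlt : 0 ≤ Real.log t := Real.log_nonneg ht
  rcases le_or_gt 0 (x ^ 2 - 2 * Real.log t) with h0 | h0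
  · set y := Real.sqrt (x ^ 2 - 2 * Real.log t) with hy
    have hy2 : y ^ 2 = x ^ 2 - 2 * Real.log t := Real.sq_sqrt h0
    have hyx : y ≤ x := Real.sqrt_le_iff.2 ⟨hx.le, by linarith⟩
    have hy0 : 0 ≤ y := Real.sqrt_nonneg _
    have hexp : Real.exp (-y ^ 2 / 2) = Real.exp (-x ^ 2 / 2) * t := by
      rw [hy2, ← Real.exp_log (by linarith : 0 < t), ← Real.exp_add, Real.log_exp]
      ring_nf
    refine (measure_mono fun a ha m => ?_).trans
      (pi_gaussianReal_forall_lt_le_exp (B := A * t) e hy0 ?_)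
    · exact (hmax a m).trans_lt ((le_max_left _ _).trans_lt
        ((Real.lt_sqrt (le_max_right _ _)).2 (hlog a ha)))
    -- Lowering the level from x to y multiplies the exponential factor by t, and y ≤ x only
    -- increases 1/(1+y).
    · have h1 : gaussianTailLower x * t ≤ gaussianTailLower y := by
        rw [gaussianTailLower, gaussianTailLower, hexp, mul_assoc]
        gcongr
      calc A * t ≤ 2 ^ ℓ * gaussianTailLower x * t := by gcongr
        _ = 2 ^ ℓ * (gaussianTailLower x * t) := mul_assoc _ _ _
        _ ≤ 2 ^ ℓ * gaussianTailLower y := by gcongr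
        _ = _ := by simp
  · have : {a | t < Real.exp ((x ^ 2 - max (X a) 0 ^ 2) / 2)} = ∅ := by
      refine Set.eq_empty_of_forall_notMem fun a ha => ?_
      have := hlog a ha
      nlinarith [sq_nonneg (max (X a) 0)]
    rw [this, measure_empty]
    exact zero_le

/-- Achievability for `τ` bounded away from `1`: a constant multiple of the reciprocal tail
probability suffices, uniformly in `δ` and `ε`. -/
lemma oneWayAchievable_of_tsum_le {δ ε τ A : ℝ} {ℓ j : ℕ} (hδ : 0 < δ) (hδ1 : δ < 1)
    (hε : 0 < ε) (hε1 : ε < 1) (hτ : 0 < τ) (hj : 2 * τ ^ 2 ≤ j * (1 - τ ^ 2))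
    (hA : ∑' k : ℕ, ENNReal.ofReal (((k : ℝ) + 2) ^ j * Real.exp (-(A * (k + 1))))
      ≤ ENNReal.ofReal (1 / 2))
    (hℓ : A ≤ 2 ^ ℓ * gaussianTailLower (maxThreshold δ ε τ)) :
    OneWayAchievable δ ε τ ℓ := by
  refine oneWayAchievable_of_lintegral_le hδ hε hε1 fun n e X hX hmax ρ hρ => ?_
  have hx0 := maxThreshold_pos (δ := δ) hε hε1 hτ
  set x := maxThreshold δ ε τ with hx
  set T : (Fin n → ℝ) → ℝ := fun a => Real.exp ((x ^ 2 - max (X a) 0 ^ 2) / 2) with hT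
  have hTm : Measurable T := by fun_prop
  have hE : ∀ k : ℕ, MeasurableSet {a | (k : ℝ) + 1 < T a} := fun k =>
    measurableSet_lt measurable_const hTm
  calc _ ≤ ∫⁻ a, (ENNReal.ofReal (δ / 2) + ∑' k : ℕ, {a | (k : ℝ) + 1 < T a}.indicator
          (fun _ => ENNReal.ofReal (δ * ((k : ℝ) + 2) ^ j)) a)
        ∂(Measure.pi fun _ : Fin n => gaussianReal 0 1) := by
        refine lintegral_mono fun a => ?_
        rcases lt_or_ge (X a) x with h | h
        · refine (condError_le_of_lt_maxThreshold hδ hδ1 hε hε1 hτ hj hρ h).trans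
            (le_trans ?_ le_add_self)
          have hT1 : 1 < T a := by
            refine Real.one_lt_exp_iff.2 ?_
            have h1 : max (X a) 0 < x := max_lt h hx0
            have h2 : 0 ≤ max (X a) 0 := le_max_right _ _
            nlinarith
          -- Slicing by k+1 < T ≤ k+2 covers every T > 1; the single term of this slice dominates.
          obtain ⟨k, hk⟩ : ∃ k : ℕ, ⌈T a⌉₊ = k + 2 :=
            ⟨⌈T a⌉₊ - 2, by have := Nat.lt_ceil.2 (by simpa using hT1 : ((1 : ℕ) : ℝ) < T a); omega⟩
          have h1 : T a ≤ (k : ℝ) + 2 := by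
            have := Nat.le_ceil (T a)
            rw [hk] at this
            exact_mod_cast this
          have h2 : (k : ℝ) + 1 < T a := by
            have := Nat.lt_ceil.1 (by omega : k + 1 < ⌈T a⌉₊)
            exact_mod_cast this
          refine le_trans ?_ (ENNReal.le_tsum k)
          rw [Set.indicator_of_mem (by exact h2)]
          refine ENNReal.ofReal_le_ofReal ?_
          change δ * T a ^ j ≤ _
          gcongr
        · exact (condError_le_of_maxThreshold_le hδ hδ1 hτ hρ h).trans le_self_add
    _ = ENNReal.ofReal (δ / 2) + ∑' k : ℕ, ENNReal.ofReal (δ * ((k : ℝ) + 2) ^ j)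
        * (Measure.pi fun _ : Fin n => gaussianReal 0 1) {a | (k : ℝ) + 1 < T a} := by
        rw [lintegral_add_left measurable_const,
          lintegral_tsum fun k => (measurable_const.indicator (hE k)).aemeasurable]
        simp_rw [lintegral_indicator_const (hE _)]
        simp
    _ ≤ ENNReal.ofReal (δ / 2) + ∑' k : ℕ, ENNReal.ofReal δ
        * ENNReal.ofReal (((k : ℝ) + 2) ^ j * Real.exp (-(A * (k + 1)))) := by
        refine add_le_add le_rfl (ENNReal.tsum_le_tsum fun k => ?_)
        rw [← ENNReal.ofReal_mul hδ.le, ← mul_assoc,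
          ENNReal.ofReal_mul (p := δ * ((k : ℝ) + 2) ^ j) (by positivity)]
        gcongr
        exact pi_gaussianReal_lt_exp_le e hmax hx0
          (by linarith [(Nat.cast_nonneg k : (0 : ℝ) ≤ k)]) hℓ
    _ ≤ ENNReal.ofReal (δ / 2) + ENNReal.ofReal δ * ENNReal.ofReal (1 / 2) := by
        rw [ENNReal.tsum_mul_left]
        gcongr
    _ = ENNReal.ofReal δ := by
        rw [← ENNReal.ofReal_mul hδ.le, ← ENNReal.ofReal_add (by positivity) (by positivity)]
        congr 1
        ring

/-! ### Counting bits and absorbing constants. -/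

lemma sq_maxThreshold {δ ε τ : ℝ} (hτ1 : τ ^ 2 ≤ 1) :
    maxThreshold δ ε τ ^ 2 = 2 / τ ^ 2 * (Real.sqrt (Real.log (1 / ε))
      + Real.sqrt ((1 - τ ^ 2) * Real.log (1 / δ))) ^ 2 := by
  rw [maxThreshold, Real.sqrt_mul (x := 1 - τ ^ 2) (by linarith), Real.sqrt_mul zero_le_two,
    Real.sqrt_mul zero_le_two]
  have h2 := Real.sq_sqrt (zero_le_two (α := ℝ))
  generalize Real.sqrt 2 = a at h2
  rw [← h2]
  ring

/-- The main term of the bound in terms of the threshold. -/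
lemma one_div_sq_mul_logb_eq {δ ε τ : ℝ} (hτ1 : τ ^ 2 ≤ 1) :
    1 / τ ^ 2 * (Real.sqrt (Real.logb 2 (1 / ε))
      + Real.sqrt ((1 - τ ^ 2) * Real.logb 2 (1 / δ))) ^ 2
        = maxThreshold δ ε τ ^ 2 / (2 * Real.log 2) := by
  have hl2 : 0 < Real.log 2 := Real.log_pos one_lt_two
  rw [sq_maxThreshold hτ1, Real.logb, Real.logb, ← mul_div_assoc, Real.sqrt_div' _ hl2.le,
    Real.sqrt_div' _ hl2.le, ← add_div, div_pow, Real.sq_sqrt hl2.le]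
  field_simp

lemma sqrt_log_mul_log_le_logb {δ ε : ℝ} (hδ : 0 < δ) (hδ1 : δ < 1) (hε : 0 < ε) (hε1 : ε < 1) :
    Real.sqrt (Real.log (1 / δ) * Real.log (1 / ε))
      ≤ Real.sqrt (Real.logb 2 (1 / δ) * Real.logb 2 (1 / ε)) := by
  have hl2 : 0 < Real.log 2 := Real.log_pos one_lt_two
  have hl21 : Real.log 2 ≤ 1 := by linarith [Real.log_two_lt_d9]
  have hE : 0 < Real.log (1 / ε) := Real.log_pos (by rw [lt_div_iff₀ hε]; linarith)
  have hD : 0 < Real.log (1 / δ) := Real.log_pos (by rw [lt_div_iff₀ hδ]; linarith)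
  refine Real.sqrt_le_sqrt (mul_le_mul ?_ ?_ hE.le (div_pos hD hl2).le)
  · exact le_div_self hD.le hl2 hl21
  · exact le_div_self hE.le hl2 hl21

/-- The number of bits needed to have enough samples. -/
lemma exists_bits_le : ∃ C : ℝ, 0 ≤ C ∧ ∀ A x : ℝ, 1 ≤ A → 0 < x →
    ∃ ℓ : ℕ, A ≤ 2 ^ ℓ * gaussianTailLower x ∧
      (ℓ : ℝ) ≤ x ^ 2 / (2 * Real.log 2) + 1 / (2 * Real.log 2) * Real.log (x ^ 2 + 1)
        + Real.log A / Real.log 2 + C := by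
  have hl2 : 0 < Real.log 2 := Real.log_pos one_lt_two
  have hpi : 1 ≤ Real.sqrt (2 * Real.pi) := by
    rw [Real.one_le_sqrt]
    linarith [Real.pi_gt_three]
  have hC : 0 ≤ Real.log (Real.sqrt (2 * Real.pi)) := Real.log_nonneg hpi
  refine ⟨(Real.log (Real.sqrt (2 * Real.pi)) + 3 / 2) / Real.log 2 + 3 / 2, by positivity,
    fun A x hA hx => ?_⟩
  have hq := gaussianTailLower_pos hx.le
  have hlogq : Real.log (gaussianTailLower x) = -(Real.log (Real.sqrt (2 * Real.pi)) + 3 / 2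
      + Real.log (1 + x) + x ^ 2 / 2) := by
    have : 0 < Real.sqrt (2 * Real.pi) := by linarith
    rw [gaussianTailLower, Real.log_mul (by positivity) (by positivity),
      Real.log_div (by positivity) (by positivity), Real.log_mul (by positivity) (by positivity),
      Real.log_inv, Real.log_exp, Real.log_exp]
    ring
  -- From (1+x)² ≤ 2(x²+1); the halving yields the coefficient 1/(2 ln 2).
  have hlx : Real.log (1 + x) ≤ Real.log 2 / 2 + Real.log (x ^ 2 + 1) / 2 := by
    have h : Real.log ((1 + x) ^ 2) ≤ Real.log (2 * (x ^ 2 + 1)) :=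
      Real.log_le_log (by positivity) (by nlinarith [sq_nonneg (x - 1)])
    rw [Real.log_pow, Real.log_mul two_ne_zero (by positivity)] at h
    push_cast at h
    linarith
  have hlx0 : 0 ≤ Real.log (1 + x) := Real.log_nonneg (by linarith)
  have hlA : 0 ≤ Real.log A := Real.log_nonneg hA
  have hlog : Real.logb 2 (A / gaussianTailLower x) = (Real.log A
      + (Real.log (Real.sqrt (2 * Real.pi)) + 3 / 2 + Real.log (1 + x) + x ^ 2 / 2))
        / Real.log 2 := by
    rw [Real.logb, Real.log_div (by positivity) hq.ne', hlogq, sub_neg_eq_add]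
  refine ⟨⌈Real.logb 2 (A / gaussianTailLower x)⌉₊, ?_, ?_⟩
  · rw [← div_le_iff₀ hq, ← Real.rpow_natCast, ← Real.logb_le_iff_le_rpow one_lt_two (by positivity)]
    exact Nat.le_ceil _
  · refine (Nat.ceil_lt_add_one (by rw [hlog]; positivity)).le.trans ?_
    rw [hlog]
    have h : Real.log (1 + x) / Real.log 2 ≤ 1 / 2 + Real.log (x ^ 2 + 1) / 2 / Real.log 2 := by
      rw [div_le_iff₀ hl2, add_mul, div_mul_cancel₀ _ hl2.ne']
      linarith
    have e1 : ∀ a b c d : ℝ, (a + (b + 3 / 2 + c + d / 2)) / Real.log 2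
        = d / (2 * Real.log 2) + c / Real.log 2 + a / Real.log 2 + (b + 3 / 2) / Real.log 2 := by
      intros; field_simp; ring
    have e2 : 1 / (2 * Real.log 2) * Real.log (x ^ 2 + 1)
        = Real.log (x ^ 2 + 1) / 2 / Real.log 2 := by field_simp
    rw [e1, e2]
    linarith

/-- With `log_le_sq_maxThreshold`, this keeps ε, and δ when τ ≤ c, away from 0 as long as the
threshold is bounded. -/
lemma two_mul_log_le_sq_maxThreshold {δ ε τ : ℝ} (hε : 0 < ε) (hε1 : ε < 1)
    (hτ : 0 < τ) (hτ1 : τ ≤ 1) : 2 * Real.log (1 / ε) ≤ maxThreshold δ ε τ ^ 2 := by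
  have hE : 0 < Real.log (1 / ε) := Real.log_pos (by rw [lt_div_iff₀ hε]; linarith)
  rw [← Real.sqrt_le_left (maxThreshold_pos hε hε1 hτ).le, maxThreshold, le_div_iff₀ hτ]
  have h1 := mul_nonneg (Real.sqrt_nonneg (1 - τ ^ 2)) (Real.sqrt_nonneg (2 * Real.log (1 / δ)))
  nlinarith [Real.sqrt_nonneg (2 * Real.log (1 / ε))]

lemma log_le_sq_maxThreshold {δ ε τ : ℝ} (hδ : 0 < δ) (hδ1 : δ < 1) (hτ : 0 < τ) (hτ1 : τ ≤ 1) :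
    (1 - τ ^ 2) * (2 * Real.log (1 / δ)) ≤ τ ^ 2 * maxThreshold δ ε τ ^ 2 := by
  have hD : 0 < Real.log (1 / δ) := Real.log_pos (by rw [lt_div_iff₀ hδ]; linarith)
  have h1 : 0 ≤ 1 - τ ^ 2 := by nlinarith
  rw [← mul_pow, mul_maxThreshold _ _ hτ]
  calc _ = (Real.sqrt (1 - τ ^ 2) * Real.sqrt (2 * Real.log (1 / δ))) ^ 2 := by
        rw [mul_pow, Real.sq_sqrt h1, Real.sq_sqrt (by positivity)]
    _ ≤ _ := by
        gcongr
        exact le_add_of_nonneg_left (Real.sqrt_nonneg _)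

lemma one_sub_le_log_one_div {δ : ℝ} (hδ : 0 < δ) : 1 - δ ≤ Real.log (1 / δ) := by
  rw [one_div, Real.log_inv]
  linarith [Real.log_le_sub_one_of_pos hδ]

/-- The slack in the logarithmic term together with the error term absorbs every constant. -/
lemma exists_const_absorb {c C : ℝ} (hc : 0 < c) (hc1 : c < 1) (hC : 0 ≤ C) :
    ∃ K : ℝ, 0 ≤ K ∧ ∀ δ ε τ : ℝ, 0 < δ → δ < 1 → 0 < ε → ε < 1 → 0 < τ → τ ≤ 1 →
      (τ ≤ c ∨ ε ≤ c) → δ + ε < 1 →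
      1 / (2 * Real.log 2) * Real.log (maxThreshold δ ε τ ^ 2 + 1) + C
        ≤ Real.log (maxThreshold δ ε τ ^ 2 + 1)
          + K * Real.sqrt (Real.log (1 / δ) * Real.log (1 / ε)) := by
  have hβ : 1 / (2 * Real.log 2) < 1 := by
    rw [div_lt_one (by positivity)]
    linarith [Real.log_two_gt_d9]
  set b := 1 / (2 * Real.log 2)
  have hc2 : 0 < 1 - c ^ 2 := by nlinarith
  -- Once x² + 1 ≥ B, the slack (1-b) log(x²+1) exceeds C.
  set B := Real.exp (C / (1 - b)) with hB
  have hB0 : 0 < B := Real.exp_pos _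
  have hEc : 0 < Real.log (1 / c) := Real.log_pos (by rw [lt_div_iff₀ hc]; linarith)
  -- For x² + 1 < B these are lower bounds for ε and, if τ ≤ c, for δ. Then δ + ε < 1 gives log(1/δ)
  -- ≥ 1 - δ ≥ ε ≥ u, and likewise log(1/ε) ≥ v.
  set u := Real.exp (-B) with hu
  set v := Real.exp (-(B / (1 - c ^ 2))) with hv
  set m := u * min (Real.log (1 / c)) v with hm
  have hm0 : 0 < m := mul_pos (Real.exp_pos _) (lt_min hEc (Real.exp_pos _))
  refine ⟨C / Real.sqrt m, by positivity, fun δ ε τ hδ hδ1 hε hε1 hτ hτ1 h hδε => ?_⟩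
  set x2 := maxThreshold δ ε τ ^ 2 with hx2
  have hx0 : 0 ≤ x2 := sq_nonneg _
  have hexp : ∀ {t : ℝ}, 0 < t → t = Real.exp (-Real.log (1 / t)) := fun ht => by
    rw [one_div, Real.log_inv, neg_neg, Real.exp_log ht]
  rcases le_or_gt B (x2 + 1) with hxB | hxB
  · have h1 : C / (1 - b) ≤ Real.log (x2 + 1) :=
      (Real.le_log_iff_exp_le (by linarith)).2 hxB
    rw [div_le_iff₀ (by linarith)] at h1
    have h2 : 0 ≤ C / Real.sqrt m * Real.sqrt (Real.log (1 / δ) * Real.log (1 / ε)) := by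
      positivity
    linarith
  · have hE := two_mul_log_le_sq_maxThreshold (δ := δ) hε hε1 hτ hτ1
    have hD := log_le_sq_maxThreshold (ε := ε) hδ hδ1 hτ hτ1
    rw [← hx2] at hE hD
    have hE0 : 0 < Real.log (1 / ε) := Real.log_pos (by rw [lt_div_iff₀ hε]; linarith)
    have hD0 : 0 < Real.log (1 / δ) := Real.log_pos (by rw [lt_div_iff₀ hδ]; linarith)
    have huD : u ≤ Real.log (1 / δ) := by
      refine le_trans ?_ (one_sub_le_log_one_div hδ)
      refine le_trans ?_ (by linarith : ε ≤ 1 - δ)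
      rw [hexp hε]
      exact Real.exp_le_exp.2 (by linarith)
    have hvE : min (Real.log (1 / c)) v ≤ Real.log (1 / ε) := by
      rcases h with h | h
      · refine (min_le_right _ _).trans (le_trans ?_ (one_sub_le_log_one_div hε))
        refine le_trans ?_ (by linarith : δ ≤ 1 - ε)
        rw [hexp hδ]
        refine Real.exp_le_exp.2 (neg_le_neg ?_)
        rw [le_div_iff₀ hc2]
        have hτc : τ ^ 2 ≤ c ^ 2 := pow_le_pow_left₀ hτ.le h 2
        nlinarith
      · refine (min_le_left _ _).trans ?_
        exact Real.log_le_log (by positivity) (one_div_le_one_div_of_le hε h)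
    have hmDE : m ≤ Real.log (1 / δ) * Real.log (1 / ε) :=
      mul_le_mul huD hvE (lt_min hEc (Real.exp_pos _)).le hD0.le
    have h1 : C ≤ C / Real.sqrt m * Real.sqrt (Real.log (1 / δ) * Real.log (1 / ε)) := by
      rw [div_mul_eq_mul_div, le_div_iff₀ (Real.sqrt_pos.2 hm0)]
      gcongr
    have h2 : 0 ≤ Real.log (x2 + 1) := Real.log_nonneg (by linarith)
    nlinarith

lemma log_one_add_le_two_mul_sqrt {D : ℝ} (hD : 0 ≤ D) : Real.log (1 + D) ≤ 2 * Real.sqrt D := by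
  have hs := Real.sqrt_nonneg D
  have h1 : Real.log (1 + D) ≤ Real.log ((1 + Real.sqrt D) ^ 2) :=
    Real.log_le_log (by linarith) (by nlinarith [Real.sq_sqrt hD])
  have h2 := Real.log_le_sub_one_of_pos (by linarith : 0 < 1 + Real.sqrt D)
  rw [Real.log_pow] at h1
  push_cast at h1
  linarith

/-- Messages of length `x² / (2 log 2) + log (x² + 1) / (2 log 2) + O(1 + √(log (1/δ) log (1/ε)))`
suffice, where `x` is the threshold for the largest sample. -/
lemma exists_oneWayAchievable_le {c : ℝ} (hc : 0 < c) (hc1 : c < 1) :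
    ∃ C K : ℝ, 0 ≤ C ∧ 0 ≤ K ∧ ∀ δ ε τ : ℝ, 0 < δ → δ < 1 → 0 < ε → ε < 1 → 0 < τ → τ ≤ 1 →
      (τ ≤ c ∨ ε ≤ c) → ∃ ℓ : ℕ, OneWayAchievable δ ε τ ℓ ∧
        (ℓ : ℝ) ≤ maxThreshold δ ε τ ^ 2 / (2 * Real.log 2)
          + 1 / (2 * Real.log 2) * Real.log (maxThreshold δ ε τ ^ 2 + 1) + C
          + K * Real.sqrt (Real.log (1 / δ) * Real.log (1 / ε)) := by
  have hl2 : 0 < Real.log 2 := Real.log_pos one_lt_two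
  have hc2 : 0 < 1 - c ^ 2 := by nlinarith
  obtain ⟨C₀, hC₀, hbits⟩ := exists_bits_le
  -- Chosen so that 2τ² ≤ j(1-τ²) for every τ ≤ c.
  set j := ⌈2 * c ^ 2 / (1 - c ^ 2)⌉₊ with hj
  obtain ⟨A, hA1, hA⟩ := exists_tsum_pow_mul_exp_le j
  have hlA : 0 ≤ Real.log A := Real.log_nonneg hA1
  have hEc : 0 < Real.log (1 / c) := Real.log_pos (by rw [lt_div_iff₀ hc]; linarith)
  refine ⟨Real.log A / Real.log 2 + C₀, 2 / Real.log 2 / Real.sqrt (Real.log (1 / c)),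
    by positivity, by positivity, fun δ ε τ hδ hδ1 hε hε1 hτ hτ1 h => ?_⟩
  have hx := maxThreshold_pos (δ := δ) hε hε1 hτ
  have hD0 : 0 < Real.log (1 / δ) := Real.log_pos (by rw [lt_div_iff₀ hδ]; linarith)
  rcases h with h | h
  · obtain ⟨ℓ, h1, h2⟩ := hbits A _ hA1 hx
    refine ⟨ℓ, oneWayAchievable_of_tsum_le hδ hδ1 hε hε1 hτ ?_ hA h1, ?_⟩
    · have h3 : 2 * c ^ 2 ≤ j * (1 - c ^ 2) := (div_le_iff₀ hc2).1 (Nat.le_ceil _)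
      have hτc : τ ^ 2 ≤ c ^ 2 := pow_le_pow_left₀ hτ.le h 2
      calc 2 * τ ^ 2 ≤ 2 * c ^ 2 := by gcongr
        _ ≤ j * (1 - c ^ 2) := h3
        _ ≤ j * (1 - τ ^ 2) := by gcongr
    · have : 0 ≤ 2 / Real.log 2 / Real.sqrt (Real.log (1 / c))
          * Real.sqrt (Real.log (1 / δ) * Real.log (1 / ε)) := by positivity
      linarith
  · obtain ⟨ℓ, h1, h2⟩ := hbits (1 + Real.log (1 / δ)) _ (by linarith) hx
    refine ⟨ℓ, oneWayAchievable_of_log_le hδ hδ1 hε hε1 hτ (le_trans ?_ h1), ?_⟩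
    · rw [div_eq_mul_one_div, Real.log_mul two_ne_zero (by positivity)]
      linarith [Real.log_two_lt_d9]
    · have h3 := log_one_add_le_two_mul_sqrt hD0.le
      have h4 : Real.log (1 / c) ≤ Real.log (1 / ε) :=
        Real.log_le_log (by positivity) (one_div_le_one_div_of_le hε h)
      have h5 : Real.log (1 + Real.log (1 / δ)) / Real.log 2
          ≤ 2 / Real.log 2 / Real.sqrt (Real.log (1 / c))
            * Real.sqrt (Real.log (1 / δ) * Real.log (1 / ε)) := by
        rw [Real.sqrt_mul hD0.le]
        calc _ ≤ 2 * Real.sqrt (Real.log (1 / δ)) / Real.log 2 := by gcongr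
          _ = 2 / Real.log 2 / Real.sqrt (Real.log (1 / c))
              * (Real.sqrt (Real.log (1 / δ)) * Real.sqrt (Real.log (1 / c))) := by
              field_simp
          _ ≤ _ := by gcongr
      have : 0 ≤ Real.log A / Real.log 2 := by positivity
      linarith

lemma OneWayAchievable.exists_minOneWayComm_eq {δ ε τ : ℝ} {ℓ : ℕ} (h : OneWayAchievable δ ε τ ℓ) :
    ∃ k : ℕ, minOneWayComm δ ε τ = (k : ℕ∞) ∧ k ≤ ℓ := by
  have hle : minOneWayComm δ ε τ ≤ (ℓ : ℕ∞) := iInf₂_le ℓ h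
  obtain ⟨k, hk⟩ := ENat.ne_top_iff_exists.1 (hle.trans_lt (ENat.natCast_lt_top ℓ)).ne
  exact ⟨k, hk.symm, by rw [← hk] at hle; exact_mod_cast hle⟩

theorem theorem1 :
    ∀ c : ℝ, 0 < c → c < 1 → ∃ K : ℝ, ∀ δ ε τ : ℝ,
      0 < δ → δ < 1 → 0 < ε → ε < 1 → 0 < τ → τ ≤ 1 → (τ ≤ c ∨ ε ≤ c) →
      ∃ ℓ : ℕ, minOneWayComm δ ε τ = (ℓ : ℕ∞) ∧
        (ℓ : ℝ) ≤
          1 / τ ^ 2 * (Real.sqrt (Real.logb 2 (1 / ε))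
              + Real.sqrt ((1 - τ ^ 2) * Real.logb 2 (1 / δ))) ^ 2
          + Real.log (2 / τ ^ 2 * (Real.sqrt (Real.log (1 / ε))
              + Real.sqrt ((1 - τ ^ 2) * Real.log (1 / δ))) ^ 2 + 1)
          + K * Real.sqrt (Real.logb 2 (1 / δ) * Real.logb 2 (1 / ε)) := by
  intro c hc hc1
  obtain ⟨C, K₁, hC, hK₁, hach⟩ := exists_oneWayAchievable_le hc hc1
  obtain ⟨K₂, hK₂, habs⟩ := exists_const_absorb hc hc1 hC
  refine ⟨K₁ + K₂, fun δ ε τ hδ hδ1 hε hε1 hτ hτ1 h => ?_⟩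
  -- When δ and ε both approach 1 the error term vanishes and cannot absorb a constant, so this
  -- range needs a zero-bit test.
  rcases le_or_gt 1 (δ + ε) with hδε | hδε
  · obtain ⟨k, hk, hk0⟩ :=
      (oneWayAchievable_zero (τ := τ) hδ hδ1 hδε).exists_minOneWayComm_eq
    refine ⟨k, hk, ?_⟩
    rw [Nat.le_zero.1 hk0, Nat.cast_zero]
    have : 0 ≤ Real.log (2 / τ ^ 2 * (Real.sqrt (Real.log (1 / ε))
        + Real.sqrt ((1 - τ ^ 2) * Real.log (1 / δ))) ^ 2 + 1) :=
      Real.log_nonneg (le_add_of_nonneg_left (by positivity))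
    positivity
  · obtain ⟨ℓ, hℓ, hle⟩ := hach δ ε τ hδ hδ1 hε hε1 hτ hτ1 h
    obtain ⟨k, hk, hkℓ⟩ := hℓ.exists_minOneWayComm_eq
    refine ⟨k, hk, (Nat.cast_le.2 hkℓ).trans (hle.trans ?_)⟩
    have h1 := habs δ ε τ hδ hδ1 hε hε1 hτ hτ1 h hδε
    have h2 := sqrt_log_mul_log_le_logb hδ hδ1 hε hε1
    rw [one_div_sq_mul_logb_eq (pow_le_one₀ hτ.le hτ1), ← sq_maxThreshold (pow_le_one₀ hτ.le hτ1)]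
    have h3 := mul_le_mul_of_nonneg_left h2 (add_nonneg hK₁ hK₂)
    linarith
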